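/- A numerical semigroup is a subset $S\subseteq\mathbb Z_{\ge 0}$ with finite complement that contains $0$ and is closed under addition. For $0<m\in S$ let $\mathrm{Ap}(S;m)=\{n\in S: n-m\notin S\}$; it contains exactly one element $a_i$ in each residue class $i\in\mathbb Z_m$, and $(a_i)_{i\in\mathbb Z_m\setminus\{0\}}\in\mathbb R^{m-1}$ is called the Apéry tuple of $S$ with respect to $m$. For a finite abelian group $G$, the group cone $\mathcal C(G)\subset\mathbb R^{G\setminus\{0\}}$ is the set of all $x$ with $x_i+x_j\ge x_{i+j}$ for all $i,j\in G\setminus\{0\}$ with $i+j\ne 0$. A face of $\mathcal C(G)$ is a subset obtained by turning some (possibly empty) collection of these inequalities into equalities; its dimension is the dimension of its affine span, and its relative interior is the set of its points that lie in no properly smaller face. We say that $S$ lies in a face $F$ of $\mathcal C(\mathbb Z_m)$ if the Apéry tuple of $S$ with respect to $m$ lies in the relative interior of $F$. Let $S=\langle m,n_2,\ldots,n_k\rangle$ be a numerical semigroup generated by positive integers $m,n_2,\dots,n_k$, let $\beta\ge 2$ be an integer, and let $\alpha\in S\setminus\{m,n_2,\ldots,n_k\}$ with $\gcd(\alpha,\beta)=1$,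 so that $T=\langle\alpha\rangle+\beta S=\langle\alpha,\beta m,\beta n_2,\ldots,\beta n_k\rangle$ is a monoscopic gluing of $S$. If $S$ lies in the face $F$ of $\mathcal C(\mathbb Z_m)$ and $T$ lies in the face $F'$ of $\mathcal C(\mathbb Z_{\beta m})$, then $$\dim F'=\begin{cases}\dim F & \text{if }\alpha\in\mathrm{Ap}(S;m),\\ \dim F+1 & \text{if }\alpha\notin\mathrm{Ap}(S;m).\end{cases}$$ -/

import Mathlib

namespace Kunz

/-- A numerical semigroup: an additive submonoid of `ℕ` with finite complement. -/
def IsNumericalSemigroup (S : AddSubmonoid ℕ) : Prop :=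
  ((S : Set ℕ)ᶜ).Finite

/-- The Apéry set `Ap(S; m) = {n ∈ S : n - m ∉ S}`, the difference being taken in `ℤ`:
`n - m ∈ S` means that `n = s + m` for some `s ∈ S`. -/
def aperySet (S : AddSubmonoid ℕ) (m : ℕ) : Set ℕ :=
  {n | n ∈ S ∧ ¬ ∃ s ∈ S, n = s + m}

/-- The element of `Ap(S; m)` in the residue class `i` modulo `m`. When `S` is a numerical
semigroup and `0 < m ∈ S` there is exactly one, so that `sInf` just picks it out. -/
noncomputable def aperyElement (S : AddSubmonoid ℕ) (m : ℕ) (i : ZMod m) : ℕ :=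
  sInf {n | n ∈ aperySet S m ∧ (n : ZMod m) = i}

/-- The Apéry tuple of `S` with respect to `m`, a point of `ℝ^(m-1)` with coordinates indexed
by the nonzero elements of `ℤ/m`. -/
noncomputable def aperyTuple (S : AddSubmonoid ℕ) (m : ℕ) : {g : ZMod m // g ≠ 0} → ℝ :=
  fun i => (aperyElement S m i.1 : ℝ)

/-- The monoscopic gluing `⟨α⟩ + βS`, where `S` is the numerical semigroup generated by the
finite set `A`: here `β ≥ 2`, `α ∈ S \ A`, and `gcd(α, β) = 1`. -/
structure IsMonoscopicGluing (A : Finset ℕ) (S : AddSubmonoid ℕ) (α β : ℕ)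
    (T : AddSubmonoid ℕ) : Prop where
  isNumericalSemigroup : IsNumericalSemigroup S
  closure_eq : AddSubmonoid.closure (A : Set ℕ) = S
  two_le : 2 ≤ β
  mem : α ∈ S
  notMem : α ∉ A
  coprime : Nat.gcd α β = 1
  eq_sup : T = AddSubmonoid.closure {α} ⊔ S.map (AddMonoidHom.mulLeft β)

section GroupCone

variable {G : Type*} [AddCommGroup G]

/-- The index set of the inequalities of the group cone: pairs of nonzero elements of `G` with
nonzero sum. -/
structure FacetIndex (G : Type*) [AddCommGroup G] where
  i : G
  j : G
  i_ne : i ≠ 0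
  j_ne : j ≠ 0
  add_ne : i + j ≠ 0

/-- The group cone `C(G)` of a finite abelian group `G`, in the real space with coordinates
indexed by `G \ {0}`: it is cut out by `x_i + x_j ≥ x_{i+j}` for nonzero `i`, `j` with
`i + j ≠ 0`. -/
def groupCone (G : Type*) [AddCommGroup G] : Set ({g : G // g ≠ 0} → ℝ) :=
  {x | ∀ p : FacetIndex G, x ⟨p.i, p.i_ne⟩ + x ⟨p.j, p.j_ne⟩ ≥ x ⟨p.i + p.j, p.add_ne⟩}

/-- The facet of `C(G)` on which the inequality with index `p` is an equality. -/
def facet (p : FacetIndex G) : Set ({g : G // g ≠ 0} → ℝ) :=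
  {x | x ∈ groupCone G ∧ x ⟨p.i, p.i_ne⟩ + x ⟨p.j, p.j_ne⟩ = x ⟨p.i + p.j, p.add_ne⟩}

/-- A face of `C(G)`: the intersection of `C(G)` with some (possibly empty) collection of its
facets. -/
def IsFace (F : Set ({g : G // g ≠ 0} → ℝ)) : Prop :=
  ∃ I : Set (FacetIndex G), F = groupCone G ∩ ⋂ p ∈ I, facet p

/-- The relative interior of a face `F` of `C(G)`: the points of `F` that lie in no face
properly contained in `F`. -/
def relInterior (F : Set ({g : G // g ≠ 0} → ℝ)) : Set ({g : G // g ≠ 0} → ℝ) :=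
  {x | x ∈ F ∧ ∀ E, IsFace E → E ⊂ F → x ∉ E}

/-- The dimension of a face: the dimension of its affine span. -/
noncomputable def faceDim (F : Set ({g : G // g ≠ 0} → ℝ)) : ℕ :=
  Module.finrank ℝ (affineSpan ℝ F).direction

end GroupCone

/-- `F` is a face of `C(ℤ/m)` and `S` lies in `F`: the Apéry tuple of `S` with respect to `m` is
in the relative interior of `F`. -/
def LiesInFace (S : AddSubmonoid ℕ) (m : ℕ) (F : Set ({g : ZMod m // g ≠ 0} → ℝ)) : Prop :=
  IsFace F ∧ aperyTuple S m ∈ relInterior F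

end Kunz

/-! The dimension of a face is that of the linear space given by the equations tight at a relative
interior point (`faceDim_eq_finrank_tightSubspace`). At an Apéry tuple, an inequality is tight
exactly when the sum of two Apéry elements is again one, so this space is `aperyAdditive`. Every
element of `Ap(T; βm)` is `βa + kα` for a unique `a ∈ Ap(S; m)` and `k < β` (`mem_aperySet_iff`,
`repr_unique`). An additive `y` is thus determined by `f a = y (βa)`, additive on `Ap(S; m)`, and by
`y α`. The two can interact only through a carry, where `βα` moves into the `S`-part. If `α ∈ Ap(S;
m)` this forces `β y(α) = f(α)`; otherwise no carry stays in the Apéry set and `y α` is one extra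
free parameter (`exists_extension`). -/

namespace Kunz

/-! ### Faces of the group cone and their dimension -/

section GroupCone

variable {G : Type*} [AddCommGroup G]

instance [Finite G] : Finite (FacetIndex G) := by
  refine Finite.of_injective (fun p : FacetIndex G => (p.i, p.j)) ?_
  rintro ⟨i, j, _, _, _⟩ ⟨i', j', _, _, _⟩ h
  simp only [Prod.mk.injEq] at h
  obtain ⟨rfl, rfl⟩ := h
  rfl

/-- The linear subspace cut out by the inequalities of the group cone that are tight at `x`. -/
def tightSubspace (x : {g : G // g ≠ 0} → ℝ) : Submodule ℝ ({g : G // g ≠ 0} → ℝ) where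
  carrier := {y | ∀ p : FacetIndex G,
    x ⟨p.i, p.i_ne⟩ + x ⟨p.j, p.j_ne⟩ = x ⟨p.i + p.j, p.add_ne⟩ →
      y ⟨p.i, p.i_ne⟩ + y ⟨p.j, p.j_ne⟩ = y ⟨p.i + p.j, p.add_ne⟩}
  zero_mem' := by simp
  add_mem' {y z} hy hz p hp := by
    simp only [Pi.add_apply]
    linarith [hy p hp, hz p hp]
  smul_mem' c y hy p hp := by
    simp only [Pi.smul_apply, smul_eq_mul]
    rw [← hy p hp, mul_add]

theorem mem_tightSubspace {x y : {g : G // g ≠ 0} → ℝ} :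
    y ∈ tightSubspace x ↔ ∀ p : FacetIndex G,
      x ⟨p.i, p.i_ne⟩ + x ⟨p.j, p.j_ne⟩ = x ⟨p.i + p.j, p.add_ne⟩ →
        y ⟨p.i, p.i_ne⟩ + y ⟨p.j, p.j_ne⟩ = y ⟨p.i + p.j, p.add_ne⟩ :=
  Iff.rfl

/-- A face with `x` in its relative interior is cut out by the inequalities tight at `x`. -/
theorem eq_inter_tightSubspace {F : Set ({g : G // g ≠ 0} → ℝ)} (hF : IsFace F)
    {x : {g : G // g ≠ 0} → ℝ} (hx : x ∈ relInterior F) :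
    F = groupCone G ∩ tightSubspace x := by
  have hE : IsFace (groupCone G ∩ (tightSubspace x : Set ({g : G // g ≠ 0} → ℝ))) := by
    refine ⟨{p | x ⟨p.i, p.i_ne⟩ + x ⟨p.j, p.j_ne⟩ = x ⟨p.i + p.j, p.add_ne⟩}, ?_⟩
    ext y
    simp only [Set.mem_inter_iff, SetLike.mem_coe, mem_tightSubspace, Set.mem_iInter,
      Set.mem_ofPred_eq, facet]
    exact ⟨fun h => ⟨h.1, fun p hp => ⟨h.1, h.2 p hp⟩⟩, fun h => ⟨h.1, fun p hp => (h.2 p hp).2⟩⟩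
  obtain ⟨I, rfl⟩ := hF
  obtain ⟨hxF, hmin⟩ := hx
  -- Each equation defining the face is tight at `x`; minimality then excludes a strict inclusion.
  have hsub : groupCone G ∩ (tightSubspace x : Set ({g : G // g ≠ 0} → ℝ)) ⊆
      groupCone G ∩ ⋂ p ∈ I, facet p := by
    rintro y ⟨hy, hyx⟩
    refine ⟨hy, Set.mem_iInter₂.2 fun p hp => ⟨hy, hyx p ?_⟩⟩
    exact (Set.mem_iInter₂.1 hxF.2 p hp).2
  by_contra hne
  exact hmin _ hE (hsub.ssubset_of_ne (Ne.symm hne)) ⟨hxF.1, fun _ h => h⟩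

/-- The dimension of a face is the dimension of the space cut out by the inequalities that are
tight at a point of its relative interior. -/
theorem faceDim_eq_finrank_tightSubspace [Finite G] {F : Set ({g : G // g ≠ 0} → ℝ)}
    (hF : IsFace F) {x : {g : G // g ≠ 0} → ℝ} (hx : x ∈ relInterior F) :
    faceDim F = Module.finrank ℝ (tightSubspace x) := by
  have hFx := eq_inter_tightSubspace hF hx
  have hxF : x ∈ F := hx.1
  have hdir : (affineSpan ℝ F).direction = tightSubspace x := by
    rw [direction_affineSpan]
    apply le_antisymm
    · rw [vectorSpan_def, Submodule.span_le]
      rintro _ ⟨y, hy, z, hz, rfl⟩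
      rw [hFx] at hy hz
      exact (tightSubspace x).sub_mem hy.2 hz.2
    · intro y hy
      -- Strict inequalities at `x` survive a small move along `y`, and tight ones stay tight. As
      -- there are finitely many, one `ε > 0` serves them all.
      have hev : ∀ᶠ ε : ℝ in nhdsWithin 0 (Set.Ioi 0), x + ε • y ∈ groupCone G := by
        refine Filter.eventually_all.2 fun p => ?_
        simp only [Pi.add_apply, Pi.smul_apply, smul_eq_mul]
        have hxp : x ⟨p.i, p.i_ne⟩ + x ⟨p.j, p.j_ne⟩ ≥ x ⟨p.i + p.j, p.add_ne⟩ := by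
          rw [hFx] at hxF
          exact hxF.1 p
        rcases hxp.lt_or_eq with hlt | heq
        · have hcont : Filter.Tendsto (fun ε : ℝ =>
              (x ⟨p.i, p.i_ne⟩ + ε * y ⟨p.i, p.i_ne⟩ + (x ⟨p.j, p.j_ne⟩ + ε * y ⟨p.j, p.j_ne⟩)) -
                (x ⟨p.i + p.j, p.add_ne⟩ + ε * y ⟨p.i + p.j, p.add_ne⟩)) (nhds 0)
              (nhds (x ⟨p.i, p.i_ne⟩ + x ⟨p.j, p.j_ne⟩ - x ⟨p.i + p.j, p.add_ne⟩)) := by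
            refine (Continuous.tendsto' (by fun_prop) _ _ (by simp))
          have := (hcont.eventually (lt_mem_nhds (sub_pos.2 hlt)))
          filter_upwards [this.filter_mono nhdsWithin_le_nhds] with ε hε
          linarith
        · refine Filter.Eventually.of_forall fun ε => le_of_eq ?_
          rw [← hy p heq.symm, heq]
          ring
      obtain ⟨ε, hε, hpos⟩ := (hev.and self_mem_nhdsWithin).exists
      have hmem : x + ε • y ∈ F := by
        rw [hFx]
        exact ⟨hε, (tightSubspace x).add_mem (fun _ h => h) ((tightSubspace x).smul_mem ε hy)⟩
      have hv := vsub_mem_vectorSpan ℝ hmem hxF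
      rw [vsub_eq_sub, add_sub_cancel_left] at hv
      exact (Submodule.smul_mem_iff _ (ne_of_gt hpos)).1 hv
  rw [faceDim, hdir]

end GroupCone

/-! ### Apéry sets and their additive functions -/

section Apery

variable {S : AddSubmonoid ℕ} {m : ℕ}

theorem zero_mem_aperySet (hm : 0 < m) : 0 ∈ aperySet S m :=
  ⟨S.zero_mem, by rintro ⟨s, -, h⟩; omega⟩

theorem mem_aperySet_of_add_mem {a b : ℕ} (ha : a ∈ S) (hb : b ∈ S)
    (h : a + b ∈ aperySet S m) : a ∈ aperySet S m := by
  refine ⟨ha, ?_⟩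
  rintro ⟨s, hs, rfl⟩
  exact h.2 ⟨s + b, S.add_mem hs hb, by ring⟩

theorem aperySet_eq_of_le (hmS : m ∈ S) {a b : ℕ} (ha : a ∈ aperySet S m)
    (hb : b ∈ aperySet S m) (hab : (a : ZMod m) = b) (hle : a ≤ b) : a = b := by
  obtain ⟨k, hk⟩ := (Nat.modEq_iff_dvd' hle).1 ((ZMod.natCast_eq_natCast_iff _ _ _).1 hab)
  rcases k with _ | k
  · simp only [mul_zero] at hk
    omega
  · refine absurd ⟨a + k * m, S.add_mem ha.1 ?_, ?_⟩ hb.2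
    · simpa using S.nsmul_mem hmS k
    · have : m * (k + 1) = k * m + m := by ring
      omega

theorem aperySet_injOn (hmS : m ∈ S) {a b : ℕ} (ha : a ∈ aperySet S m)
    (hb : b ∈ aperySet S m) (hab : (a : ZMod m) = b) : a = b := by
  rcases le_total a b with h | h
  · exact aperySet_eq_of_le hmS ha hb hab h
  · exact (aperySet_eq_of_le hmS hb ha hab.symm h).symm

theorem IsNumericalSemigroup.exists_forall_le_mem (hS : IsNumericalSemigroup S) :
    ∃ N, ∀ n, N ≤ n → n ∈ S := by
  obtain ⟨N, hN⟩ := hS.bddAbove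
  refine ⟨N + 1, fun n hn => ?_⟩
  by_contra h
  have : n ≤ N := hN h
  omega

theorem aperyElement_spec (hm : 0 < m) (hS : IsNumericalSemigroup S) (i : ZMod m) :
    aperyElement S m i ∈ aperySet S m ∧ (aperyElement S m i : ZMod m) = i := by
  have : NeZero m := ⟨hm.ne'⟩
  suffices h : {n | n ∈ aperySet S m ∧ (n : ZMod m) = i}.Nonempty from Nat.sInf_mem h
  have hex : ∃ n, n ∈ S ∧ (n : ZMod m) = i := by
    obtain ⟨N, hN⟩ := hS.exists_forall_le_mem
    refine ⟨i.val + m * N, hN _ ?_, by simp⟩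
    nlinarith
  -- The least element of `S` in the class lies in the Apéry set.
  classical
  obtain ⟨hn, hni⟩ := Nat.find_spec hex
  refine ⟨Nat.find hex, ⟨hn, ?_⟩, hni⟩
  rintro ⟨s, hs, h⟩
  refine Nat.find_min hex (m := s) (by omega) ⟨hs, ?_⟩
  rw [← hni, h]
  simp

theorem aperyElement_natCast (hm : 0 < m) (hmS : m ∈ S) (hS : IsNumericalSemigroup S) {n : ℕ}
    (hn : n ∈ aperySet S m) : aperyElement S m n = n :=
  aperySet_injOn hmS (aperyElement_spec hm hS n).1 hn (aperyElement_spec hm hS n).2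

/-- The real functions supported on the Apéry set that are additive as far as sums stay in the
Apéry set. -/
def aperyAdditive (S : AddSubmonoid ℕ) (m : ℕ) : Submodule ℝ (ℕ → ℝ) where
  carrier := {f | (∀ n ∉ aperySet S m, f n = 0) ∧ ∀ a ∈ aperySet S m, ∀ b ∈ aperySet S m,
    a + b ∈ aperySet S m → f (a + b) = f a + f b}
  zero_mem' := by simp
  add_mem' {f g} hf hg := by
    refine ⟨fun n hn => by simp [hf.1 n hn, hg.1 n hn], fun a ha b hb hab => ?_⟩
    simp only [Pi.add_apply, hf.2 a ha b hb hab, hg.2 a ha b hb hab]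
    ring
  smul_mem' c f hf := by
    refine ⟨fun n hn => by simp [hf.1 n hn], fun a ha b hb hab => ?_⟩
    simp only [Pi.smul_apply, hf.2 a ha b hb hab, smul_add]

theorem aperyAdditive_apply_zero (hm : 0 < m) {f : ℕ → ℝ} (hf : f ∈ aperyAdditive S m) :
    f 0 = 0 := by
  have h0 := zero_mem_aperySet (S := S) hm
  have := hf.2 0 h0 0 h0 h0
  simp only [add_zero] at this
  linarith

/-- Restriction of additive functions on the Apéry set to the nonzero residue classes. -/
noncomputable def aperyAdditiveToTuple (hm : 0 < m) (hS : IsNumericalSemigroup S) :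
    aperyAdditive S m →ₗ[ℝ] tightSubspace (aperyTuple S m) where
  toFun f := ⟨fun i => f.1 (aperyElement S m i.1), fun p hp => by
    have hp' : aperyElement S m p.i + aperyElement S m p.j = aperyElement S m (p.i + p.j) := by
      simp only [aperyTuple] at hp
      exact_mod_cast hp
    have hmem := (aperyElement_spec hm hS (p.i + p.j)).1
    rw [← hp'] at hmem
    simp only [← hp']
    exact (f.2.2 _ (aperyElement_spec hm hS p.i).1 _ (aperyElement_spec hm hS p.j).1 hmem).symm⟩
  map_add' _ _ := rfl
  map_smul' _ _ := rfl

theorem aperyAdditiveToTuple_bijective (hm : 0 < m) (hmS : m ∈ S)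
    (hS : IsNumericalSemigroup S) :
    Function.Bijective (aperyAdditiveToTuple (S := S) hm hS) := by
  constructor
  · rw [← LinearMap.ker_eq_bot, LinearMap.ker_eq_bot']
    intro f hf
    ext n
    by_cases hn : n ∈ aperySet S m
    · by_cases hn0 : (n : ZMod m) = 0
      · have : n = 0 := aperySet_injOn hmS hn (zero_mem_aperySet hm) (by simpa using hn0)
        subst this
        exact aperyAdditive_apply_zero hm f.2
      · have := congrFun (congrArg Subtype.val hf) ⟨n, hn0⟩
        change f.1 (aperyElement S m n) = 0 at this
        rwa [aperyElement_natCast hm hmS hS hn] at this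
    · exact f.2.1 n hn
  · intro y
    classical
    -- The tuple has no coordinate for the class of zero; additivity forces the value 0 there.
    let f : ℕ → ℝ := fun n =>
      if h : n ∈ aperySet S m ∧ (n : ZMod m) ≠ 0 then y.1 ⟨n, h.2⟩ else 0
    have hf0 : f 0 = 0 := by simp [f]
    have hzero : ∀ {n}, n ∈ aperySet S m → (n : ZMod m) = 0 → n = 0 := fun hn h =>
      aperySet_injOn hmS hn (zero_mem_aperySet hm) (by simpa using h)
    have hf : f ∈ aperyAdditive S m := by
      refine ⟨fun n hn => by simp [f, hn], fun a ha b hb hab => ?_⟩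
      by_cases ha0 : (a : ZMod m) = 0
      · obtain rfl := hzero ha ha0
        simp [hf0]
      by_cases hb0 : (b : ZMod m) = 0
      · obtain rfl := hzero hb hb0
        simp [hf0]
      -- The cone has no inequality for such a pair, but none is needed: 0 is the only Apéry element
      -- in its class.
      by_cases hab0 : ((a + b : ℕ) : ZMod m) = 0
      · have := hzero hab hab0
        obtain ⟨rfl, rfl⟩ : a = 0 ∧ b = 0 := by omega
        simp [hf0]
      have hab0' : (a : ZMod m) + b ≠ 0 := by simpa using hab0
      have htight := y.2 ⟨a, b, ha0, hb0, hab0'⟩ (by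
        simp only [aperyTuple, ← Nat.cast_add, aperyElement_natCast hm hmS hS ha,
          aperyElement_natCast hm hmS hS hb, aperyElement_natCast hm hmS hS hab])
      simp only [f, ha, hb, hab, ha0, hb0, hab0', ne_eq, not_false_eq_true, and_self, dite_true,
        htight, Nat.cast_add]
    refine ⟨⟨f, hf⟩, ?_⟩
    ext i
    change f (aperyElement S m i.1) = y.1 i
    obtain ⟨h1, h2⟩ := aperyElement_spec hm hS i.1
    simp only [f, h1, h2, i.2, ne_eq, not_false_eq_true, and_self, dite_true]

/-- The space of additive functions on the Apéry set as a space of tuples. -/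
noncomputable def aperyAdditiveEquiv (hm : 0 < m) (hmS : m ∈ S) (hS : IsNumericalSemigroup S) :
    aperyAdditive S m ≃ₗ[ℝ] tightSubspace (aperyTuple S m) :=
  LinearEquiv.ofBijective _ (aperyAdditiveToTuple_bijective hm hmS hS)

theorem faceDim_eq_finrank_aperyAdditive (hm : 0 < m) (hmS : m ∈ S)
    (hS : IsNumericalSemigroup S) {F : Set ({g : ZMod m // g ≠ 0} → ℝ)}
    (hF : LiesInFace S m F) : faceDim F = Module.finrank ℝ (aperyAdditive S m) := by
  have : NeZero m := ⟨hm.ne'⟩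
  rw [faceDim_eq_finrank_tightSubspace hF.1 hF.2,
    (aperyAdditiveEquiv hm hmS hS).finrank_eq]

theorem finite_aperyAdditive (hm : 0 < m) (hmS : m ∈ S) (hS : IsNumericalSemigroup S) :
    Module.Finite ℝ (aperyAdditive S m) := by
  have : NeZero m := ⟨hm.ne'⟩
  exact Module.Finite.equiv (aperyAdditiveEquiv hm hmS hS).symm

end Apery

/-! ### Monoscopic gluings -/

section Gluing

variable {A : Finset ℕ} {S T : AddSubmonoid ℕ} {m α β : ℕ}

namespace IsMonoscopicGluing

/-- Since `α ∈ S`, each block `βα` can be absorbed into `βS`, which reduces the coefficient of `α`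
modulo `β`. -/
theorem mem_iff (hT : IsMonoscopicGluing A S α β T) {n : ℕ} :
    n ∈ T ↔ ∃ s ∈ S, ∃ k < β, n = β * s + k * α := by
  have hβ : 0 < β := by have := hT.two_le; omega
  rw [hT.eq_sup, AddSubmonoid.mem_sup]
  constructor
  · rintro ⟨y, hy, z, ⟨s, hs, rfl⟩, rfl⟩
    obtain ⟨k, rfl⟩ := AddSubmonoid.mem_closure_singleton.1 hy
    refine ⟨s + (k / β) * α, S.add_mem hs ?_, k % β, Nat.mod_lt _ hβ, ?_⟩
    · simpa using S.nsmul_mem hT.mem (k / β)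
    · simp only [smul_eq_mul, AddMonoidHom.coe_mulLeft]
      nth_rw 1 [← Nat.div_add_mod k β]
      ring
  · rintro ⟨s, hs, k, -, rfl⟩
    exact ⟨k * α, AddSubmonoid.mem_closure_singleton.2 ⟨k, by simp⟩, β * s, ⟨s, hs, rfl⟩,
      add_comm _ _⟩

theorem repr_unique (hT : IsMonoscopicGluing A S α β T) {a b k l : ℕ} (hk : k < β) (hl : l < β)
    (h : β * a + k * α = β * b + l * α) : a = b ∧ k = l := by
  have hβ : 0 < β := by omega
  have hmod : k * α ≡ l * α [MOD β] := by
    have h' : (β * a + k * α) % β = (β * b + l * α) % β := by rw [h]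
    simpa [Nat.ModEq] using h'
  have hkl : k ≡ l [MOD β] :=
    Nat.ModEq.cancel_right_of_coprime (by rw [Nat.gcd_comm]; exact hT.coprime) hmod
  obtain rfl : k = l := Nat.ModEq.eq_of_lt_of_lt hkl hk hl
  exact ⟨Nat.eq_of_mul_eq_mul_left hβ (by omega), rfl⟩

theorem isNumericalSemigroup_right (hT : IsMonoscopicGluing A S α β T) :
    IsNumericalSemigroup T := by
  have hβ := hT.two_le
  obtain ⟨N, hN⟩ := hT.isNumericalSemigroup.exists_forall_le_mem
  refine (Set.finite_Iio (β * (N + α))).subset fun n hn => ?_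
  by_contra hlt
  simp only [Set.mem_Iio, not_lt] at hlt
  refine hn (hT.mem_iff.2 ?_)
  have : NeZero β := ⟨by omega⟩
  -- This choice makes `n - kα` divisible by `β`; the bound `β(N + α)` on `n` keeps the quotient at
  -- least `N`.
  let k : ZMod β := n * (α : ZMod β)⁻¹
  have hkα : ((k.val * α : ℕ) : ZMod β) = n := by
    simp only [Nat.cast_mul, ZMod.natCast_val, ZMod.cast_id', id_eq, k]
    rw [mul_assoc, mul_comm (α : ZMod β)⁻¹, ZMod.coe_mul_inv_eq_one α hT.coprime, mul_one]
  have hk : k.val < β := ZMod.val_lt k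
  have hle : k.val * α ≤ β * α := Nat.mul_le_mul_right _ hk.le
  rw [mul_add] at hlt
  obtain ⟨s, hs⟩ := (Nat.modEq_iff_dvd' (by omega)).1
    ((ZMod.natCast_eq_natCast_iff (k.val * α) n β).1 hkα)
  refine ⟨s, hN s ?_, k.val, hk, by omega⟩
  exact Nat.le_of_mul_le_mul_left (show β * N ≤ β * s by omega) (by omega)

theorem mem_aperySet_iff (hT : IsMonoscopicGluing A S α β T) {n : ℕ} :
    n ∈ aperySet T (β * m) ↔ ∃ a ∈ aperySet S m, ∃ k < β, n = β * a + k * α := by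
  constructor
  · rintro ⟨hn, hn'⟩
    obtain ⟨s, hs, k, hk, rfl⟩ := hT.mem_iff.1 hn
    refine ⟨s, ⟨hs, ?_⟩, k, hk, rfl⟩
    rintro ⟨t, ht, rfl⟩
    exact hn' ⟨β * t + k * α, hT.mem_iff.2 ⟨t, ht, k, hk, rfl⟩, by ring⟩
  · rintro ⟨a, ha, k, hk, rfl⟩
    refine ⟨hT.mem_iff.2 ⟨a, ha.1, k, hk, rfl⟩, ?_⟩
    rintro ⟨t, ht, h⟩
    obtain ⟨s, hs, l, hl, rfl⟩ := hT.mem_iff.1 ht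
    have h' : β * a + k * α = β * (s + m) + l * α := by rw [h]; ring
    exact ha.2 ⟨s, hs, (hT.repr_unique hk hl h').1⟩

theorem repr_mem_aperySet_iff (hT : IsMonoscopicGluing A S α β T) {a k : ℕ} (hk : k < β) :
    β * a + k * α ∈ aperySet T (β * m) ↔ a ∈ aperySet S m := by
  rw [hT.mem_aperySet_iff]
  refine ⟨?_, fun ha => ⟨a, ha, k, hk, rfl⟩⟩
  rintro ⟨b, hb, l, hl, h⟩
  rwa [(hT.repr_unique hk hl h).1]

theorem mul_mem_aperySet_iff (hT : IsMonoscopicGluing A S α β T) {a : ℕ} :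
    β * a ∈ aperySet T (β * m) ↔ a ∈ aperySet S m := by
  have hβ := hT.two_le
  simpa using hT.repr_mem_aperySet_iff (m := m) (a := a) (k := 0) (by omega)

theorem mul_mem_aperySet (hT : IsMonoscopicGluing A S α β T) (hm : 0 < m) {k : ℕ} (hk : k < β) :
    k * α ∈ aperySet T (β * m) := by
  simpa using (hT.repr_mem_aperySet_iff hk).2 (zero_mem_aperySet (S := S) hm)

/-- Additive functions on the Apéry set of a gluing are determined by their values on the
multiples of `β` and at `α`. -/
theorem apply_repr (hT : IsMonoscopicGluing A S α β T) (hm : 0 < m) {y : ℕ → ℝ}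
    (hy : y ∈ aperyAdditive T (β * m)) {a k : ℕ} (ha : a ∈ aperySet S m) (hk : k < β) :
    y (β * a + k * α) = y (β * a) + k * y α := by
  induction k with
  | zero => simp
  | succ k ih =>
    have hα : α ∈ aperySet T (β * m) := by
      simpa using hT.mul_mem_aperySet hm (k := 1) (by omega)
    have hsum : β * a + (k + 1) * α = (β * a + k * α) + α := by ring
    have hmem := (hT.repr_mem_aperySet_iff hk).2 ha
    rw [hsum] at hmem ⊢
    rw [hy.2 _ ((hT.repr_mem_aperySet_iff (by omega)).2 ha) _ hα hmem, ih (by omega)]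
    push_cast
    ring

/-- The coefficient `β` is just out of reach of `apply_repr`, so `βα` is split as `(β - 1)α + α`,
whose sum is an Apéry element because `α ∈ Ap(S; m)`. -/
theorem mul_apply_eq (hT : IsMonoscopicGluing A S α β T) (hm : 0 < m) {y : ℕ → ℝ}
    (hy : y ∈ aperyAdditive T (β * m)) (hα : α ∈ aperySet S m) : β * y α = y (β * α) := by
  have hβ := hT.two_le
  obtain ⟨b, rfl⟩ : ∃ b, β = b + 1 := ⟨β - 1, by omega⟩
  have h1 : α ∈ aperySet T ((b + 1) * m) := by
    simpa using hT.mul_mem_aperySet hm (k := 1) (by omega)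
  have hmem := hT.mul_mem_aperySet_iff.2 hα
  have hsum : (b + 1) * α = b * α + α := by ring
  rw [hsum] at hmem ⊢
  rw [hy.2 _ (hT.mul_mem_aperySet hm (by omega)) _ h1 hmem]
  have h := hT.apply_repr hm hy (zero_mem_aperySet hm) (k := b) (by omega)
  rw [mul_zero, zero_add, aperyAdditive_apply_zero (Nat.mul_pos (by omega) hm) hy] at h
  rw [h]
  push_cast
  ring

theorem exists_extension (hT : IsMonoscopicGluing A S α β T) (hm : 0 < m) {f : ℕ → ℝ}
    (hf : f ∈ aperyAdditive S m) {c : ℝ} (hc : α ∈ aperySet S m → β * c = f α) :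
    ∃ y ∈ aperyAdditive T (β * m), (∀ a, y (β * a) = f a) ∧ y α = c := by
  classical
  have hβ := hT.two_le
  -- Uniqueness of the representation makes `f a + k c` a well-defined value.
  have hex : ∀ n, ∃ r : ℝ, (n ∉ aperySet T (β * m) → r = 0) ∧
      ∀ a ∈ aperySet S m, ∀ k < β, n = β * a + k * α → r = f a + k * c := by
    intro n
    by_cases hn : n ∈ aperySet T (β * m)
    · obtain ⟨a, -, k, hk, rfl⟩ := hT.mem_aperySet_iff.1 hn
      refine ⟨f a + k * c, fun h => absurd hn h, fun b _ l hl h => ?_⟩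
      obtain ⟨rfl, rfl⟩ := hT.repr_unique hk hl h
      rfl
    · refine ⟨0, fun _ => rfl, fun a ha k hk h => ?_⟩
      exact absurd (hT.mem_aperySet_iff.2 ⟨a, ha, k, hk, h⟩) hn
  choose y hy0 hy using hex
  refine ⟨y, ⟨hy0, ?_⟩, fun a => ?_, ?_⟩
  · intro u hu v hv huv
    obtain ⟨a, ha, k, hk, rfl⟩ := hT.mem_aperySet_iff.1 hu
    obtain ⟨b, hb, l, hl, rfl⟩ := hT.mem_aperySet_iff.1 hv
    rw [hy _ a ha k hk rfl, hy _ b hb l hl rfl]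
    by_cases hkl : k + l < β
    · have hsum : β * a + k * α + (β * b + l * α) = β * (a + b) + (k + l) * α := by ring
      rw [hsum] at huv
      have hab := (hT.repr_mem_aperySet_iff hkl).1 huv
      rw [hy _ _ hab _ hkl hsum, hf.2 a ha b hb hab]
      push_cast
      ring
    -- The carry: `a + b + α` is then an Apéry element, hence so is its summand `α`, and `hc`
    -- applies.
    · obtain ⟨r, hr⟩ := Nat.exists_eq_add_of_le (not_lt.1 hkl)
      have hrβ : r < β := by omega
      have hsum : β * a + k * α + (β * b + l * α) = β * (a + b + α) + r * α := by
        have : k * α + l * α = β * α + r * α := by rw [← add_mul, hr, add_mul]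
        linarith [this]
      rw [hsum] at huv
      have habα := (hT.repr_mem_aperySet_iff hrβ).1 huv
      have hab := mem_aperySet_of_add_mem (S.add_mem ha.1 hb.1) hT.mem habα
      have hα : α ∈ aperySet S m :=
        mem_aperySet_of_add_mem hT.mem (S.add_mem ha.1 hb.1) (by rwa [add_comm])
      rw [hy _ _ habα _ hrβ hsum, hf.2 _ hab _ hα habα, hf.2 a ha b hb hab, ← hc hα]
      have hr' : (k : ℝ) + l = β + r := by exact_mod_cast hr
      linear_combination (-c) * hr'
  · by_cases ha : a ∈ aperySet S m
    · simpa using hy (β * a) a ha 0 (by omega) (by simp)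
    · rw [hy0 _ (fun h => ha (hT.mul_mem_aperySet_iff.1 h)), hf.1 a ha]
  · simpa [aperyAdditive_apply_zero hm hf] using
      hy α 0 (zero_mem_aperySet hm) 1 (by omega) (by simp)

/-- Restriction of additive functions on the Apéry set of a gluing to the multiples of `β`. -/
def restrict (hT : IsMonoscopicGluing A S α β T) :
    aperyAdditive T (β * m) →ₗ[ℝ] aperyAdditive S m where
  toFun y := ⟨fun a => y.1 (β * a), fun a ha =>
      y.2.1 _ (fun h => ha (hT.mul_mem_aperySet_iff.1 h)), fun a ha b hb hab => by
    have := y.2.2 _ (hT.mul_mem_aperySet_iff.2 ha) _ (hT.mul_mem_aperySet_iff.2 hb)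
    rw [← mul_add] at this
    exact this (hT.mul_mem_aperySet_iff.2 hab)⟩
  map_add' _ _ := rfl
  map_smul' _ _ := rfl

theorem ext_of_restrict_eq (hT : IsMonoscopicGluing A S α β T) (hm : 0 < m)
    {y z : aperyAdditive T (β * m)} (h : hT.restrict y = hT.restrict z) (hα : y.1 α = z.1 α) :
    y = z := by
  ext n
  by_cases hn : n ∈ aperySet T (β * m)
  · obtain ⟨a, ha, k, hk, rfl⟩ := hT.mem_aperySet_iff.1 hn
    have ha' : y.1 (β * a) = z.1 (β * a) := congrFun (congrArg Subtype.val h) a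
    rw [hT.apply_repr hm y.2 ha hk, hT.apply_repr hm z.2 ha hk, ha', hα]
  · rw [y.2.1 n hn, z.2.1 n hn]

theorem finrank_of_mem (hT : IsMonoscopicGluing A S α β T) (hm : 0 < m)
    (hα : α ∈ aperySet S m) :
    Module.finrank ℝ (aperyAdditive T (β * m)) = Module.finrank ℝ (aperyAdditive S m) := by
  have hβ : (β : ℝ) ≠ 0 := by
    have := hT.two_le
    exact_mod_cast (by omega : β ≠ 0)
  refine (LinearEquiv.ofBijective (hT.restrict (m := m)) ⟨fun y z h => ?_, fun f => ?_⟩).finrank_eq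
  · refine hT.ext_of_restrict_eq hm h (mul_left_cancel₀ hβ ?_)
    rw [hT.mul_apply_eq hm y.2 hα, hT.mul_apply_eq hm z.2 hα]
    exact congrFun (congrArg Subtype.val h) α
  · obtain ⟨y, hy, hyf, -⟩ := hT.exists_extension hm f.2 (c := f.1 α / β)
      (fun _ => mul_div_cancel₀ _ hβ)
    exact ⟨⟨y, hy⟩, Subtype.ext (funext hyf)⟩

theorem finrank_of_notMem (hT : IsMonoscopicGluing A S α β T) (hm : 0 < m) (hmS : m ∈ S)
    (hα : α ∉ aperySet S m) :
    Module.finrank ℝ (aperyAdditive T (β * m)) = Module.finrank ℝ (aperyAdditive S m) + 1 := by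
  have := finite_aperyAdditive hm hmS hT.isNumericalSemigroup
  -- The extra factor records the now unconstrained value at `α`.
  let φ : aperyAdditive T (β * m) →ₗ[ℝ] aperyAdditive S m × ℝ :=
    hT.restrict.prod ((LinearMap.proj α).comp (aperyAdditive T (β * m)).subtype)
  have hφ : Function.Bijective φ := by
    refine ⟨fun y z h => ?_, fun ⟨f, c⟩ => ?_⟩
    · exact hT.ext_of_restrict_eq hm (congrArg Prod.fst h) (congrArg Prod.snd h)
    · obtain ⟨y, hy, hyf, hyc⟩ := hT.exists_extension hm f.2 (c := c) (fun h => absurd h hα)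
      exact ⟨⟨y, hy⟩, Prod.ext (Subtype.ext (funext hyf)) hyc⟩
  rw [(LinearEquiv.ofBijective φ hφ).finrank_eq, Module.finrank_prod, Module.finrank_self]

end IsMonoscopicGluing

end Gluing

end Kunz

theorem corollaryc (A : Finset ℕ) (S T : AddSubmonoid ℕ) (m α β : ℕ)
    (hm : 0 < m) (hmA : m ∈ A)
    (hT : Kunz.IsMonoscopicGluing A S α β T)
    (F : Set ({g : ZMod m // g ≠ 0} → ℝ)) (hF : Kunz.LiesInFace S m F)
    (F' : Set ({g : ZMod (β * m) // g ≠ 0} → ℝ)) (hF' : Kunz.LiesInFace T (β * m) F') :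
    (α ∈ Kunz.aperySet S m → Kunz.faceDim F' = Kunz.faceDim F) ∧
      (α ∉ Kunz.aperySet S m → Kunz.faceDim F' = Kunz.faceDim F + 1) := by
  have hβ := hT.two_le
  have hmS : m ∈ S := by
    rw [← hT.closure_eq]
    exact AddSubmonoid.subset_closure hmA
  have hmT : β * m ∈ T := hT.mem_iff.2 ⟨m, hmS, 0, by omega, by simp⟩
  rw [Kunz.faceDim_eq_finrank_aperyAdditive hm hmS hT.isNumericalSemigroup hF,
    Kunz.faceDim_eq_finrank_aperyAdditive (Nat.mul_pos (by omega) hm) hmT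
      hT.isNumericalSemigroup_right hF']
  exact ⟨hT.finrank_of_mem hm, hT.finrank_of_notMem hm hmS⟩
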